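/- Setting. Let $\mu$ be a singular cardinal of cofinality $\aleph_0$, let $\lambda=\mu^+$, let $\sigma$ be a regular cardinal with $\aleph_0<\sigma<\mu$, let $S$ be a stationary subset of $\{\delta<\lambda:\operatorname{cf}(\delta)=\sigma\}$, and let $\langle\mu_m:m<\omega\rangle$ be a strictly increasing sequence of regular cardinals, cofinal in $\mu$, with $\sigma<\mu_0$. For a set $C$ of ordinals let $\operatorname{acc}(C)$ be the set of all nonzero $\alpha\in C$ with $\alpha=\sup(C\cap\alpha)$, and let $\operatorname{nacc}(C)=C\setminus\operatorname{acc}(C)$. Let $\langle c^0_\delta:\delta\in S\rangle$ and $\bar C=\langle C_\delta:\delta\in S\rangle$ be such that, for every $\delta\in S$, - $c^0_\delta$ is the increasing enumeration, in order type $\sigma$, of a closed unbounded subset of $\delta$; - $C_\delta$ is a closed unbounded subset of $\delta$ with $\operatorname{ran}(c^0_\delta)\subseteq C_\delta$; - for all $\epsilon<\sigma$ and $m<\omega$, writing $I(\delta,\epsilon,m)=(c^0_\delta(\omega\cdot\epsilon+m),\,c^0_\delta(\omega\cdot\epsilon+m+1)]$, we have $|C_\delta\cap I(\delta,\epsilon,m)|\le\mu_m^+$,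 and $\operatorname{cf}(\alpha)>\mu_m^+$ for every $\alpha\in\operatorname{nacc}(C_\delta)\cap I(\delta,\epsilon,m)$; and such that, for every closed unbounded $E\subseteq\lambda$, - the set of $\delta\in S$ with $\operatorname{ran}(c^0_\delta)\subseteq E$ is stationary, and - the set of $\delta\in S$ such that $E\cap\operatorname{nacc}(C_\delta)\cap I(\delta,\epsilon,m)\neq\emptyset$ for all $\epsilon<\sigma$ and $m<\omega$ is stationary. For $\delta\in S$ let $I_\delta$ be the ideal on $C_\delta$ generated by the sets $\{\gamma\in C_\delta:\gamma\in\operatorname{acc}(C_\delta)\text{ or }\operatorname{cf}(\gamma)<\alpha\text{ or }\gamma<\beta\}$ with $\alpha<\mu$ and $\beta<\delta$. Let $\operatorname{id}_p(\bar C,\bar I)$ be the ideal of all $A\subseteq\lambda$ for which there is a closed unbounded $E\subseteq\lambda$ with $A\cap E\cap C_\delta\in I_\delta$ for all $\delta\in S\cap E$. A property holds for $\operatorname{id}_p(\bar C,\bar I)$-almost all $\beta<\lambda$ if the set of $\beta<\lambda$ where it fails belongs to $\operatorname{id}_p(\bar C,\bar I)$. For $\delta\in S$ and $m<\omega$ let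 $C_\delta[m]=\operatorname{ran}(c^0_\delta)\cup\bigcup\{C_\delta\cap I(\delta,\epsilon,i):\epsilon<\sigma,\ i\le m\}$. Let $\langle e^m_\alpha:\alpha<\lambda,m<\omega\rangle$ be a ladder-swallowing generalized $C$-sequence, that is, for all $\alpha<\lambda$ and $m<\omega$: - $e^m_\alpha$ is closed and unbounded in $\alpha$ (for $\alpha=\gamma+1$ this means that it is closed and contains $\gamma$), and $e^m_\alpha\subseteq e^{m+1}_\alpha$; - $|e^m_\alpha|\le\operatorname{cf}(\alpha)+\mu_m^+$; - $C_\delta[m]\subseteq e^m_\alpha$ for every $\delta\in S\cap e^m_\alpha$. For $\alpha<\beta<\lambda$ and $m<\omega$ put $\beta^m_0(\alpha,\beta)=\beta$, and let $\beta^m_{i+1}(\alpha,\beta)$ be $\min\bigl(e^m_{\beta^m_i(\alpha,\beta)}\setminus\alpha\bigr)$ if $\beta^m_i(\alpha,\beta)>\alpha$, and $\alpha$ otherwise. Let $\rho^m_2(\alpha,\beta)$ be the least $i$ with $\beta^m_i(\alpha,\beta)=\alpha$. The $m$-walk from $\beta$ to $\alpha$ is the sequence $\langle\beta^m_i(\alpha,\beta):i<\rho^m_2(\alpha,\beta)\rangle$,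 and it passes through each of its terms. **Theorem.** Let $\langle t_\alpha:\alpha<\lambda\rangle$ be a family of finite subsets of $\lambda$ with $t_\alpha\cap t_{\beta}=\emptyset$ for $\alpha\ne\beta$. Then for $\operatorname{id}_p(\bar C,\bar I)$-almost all $\beta^*<\lambda$ there are $\alpha<\beta<\lambda$ and $m<\omega$ such that, for all $\zeta\in t_\alpha$ and $\xi\in t_\beta$, we have $\zeta<\xi$ and the $m$-walk from $\xi$ to $\zeta$ passes through $\beta^*$. -/

import Mathlib

open Cardinal Ordinal Set Filter

universe u

noncomputable section

namespace OffCenter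

/-- `C` is a closed unbounded subset of the ordinal `δ` (of the set of ordinals below `δ`).
For `δ = γ + 1` unboundedness means `γ ∈ C`. -/
def IsClubIn (δ : Ordinal.{u}) (C : Set Ordinal.{u}) : Prop :=
  C ⊆ Iio δ ∧ IsClub (Subtype.val ⁻¹' C : Set (Iio δ))

/-- `S` is a stationary subset of the ordinal `δ`. -/
def IsStationaryIn (δ : Ordinal.{u}) (S : Set Ordinal.{u}) : Prop :=
  S ⊆ Iio δ ∧ IsStationary (Subtype.val ⁻¹' S : Set (Iio δ))

/-- The accumulation points of `C` that lie in `C`, in the order topology of the ordinals: the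
elements `α ≠ 0` of `C` with `α = sup (C ∩ α)`. -/
def acc (C : Set Ordinal.{u}) : Set Ordinal.{u} := {α ∈ C | AccPt α (𝓟 C)}

/-- The non-accumulation points of `C`. -/
def nacc (C : Set Ordinal.{u}) : Set Ordinal.{u} := C \ acc C

/-- The ordinal `λ = μ⁺`. -/
def lam (μ : Cardinal.{u}) : Ordinal.{u} := (Order.succ μ).ord

/-- The cardinals: `μ` is singular of countable cofinality, `σ` is regular with `ℵ₀ < σ < μ`,
`S` is a stationary set of ordinals below `μ⁺` of cofinality `σ`, and `ν` is a strictly increasing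
sequence of regular cardinals above `σ`, cofinal in `μ`. -/
structure IsCardinalSetup (μ σ : Cardinal.{u}) (S : Set Ordinal.{u}) (ν : ℕ → Cardinal.{u}) :
    Prop where
  singular : μ.IsSingular
  cof_eq : μ.ord.cof = ℵ₀
  aleph0_lt : ℵ₀ < σ
  regular : σ.IsRegular
  lt_mu : σ < μ
  stationary : IsStationaryIn (lam μ) S
  cof_of_mem : ∀ δ ∈ S, δ.cof = σ
  nu_strictMono : StrictMono ν
  nu_regular : ∀ i, (ν i).IsRegular
  nu_lt : ∀ i, ν i < μ
  nu_cofinal : ∀ κ < μ, ∃ i, κ < ν i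
  lt_nu : σ < ν 0

/-- The range of the enumeration `c δ`, a function on the ordinals below `σ`. -/
def ran (σ : Cardinal.{u}) (c : Ordinal.{u} → Ordinal.{u} → Ordinal.{u}) (δ : Ordinal.{u}) :
    Set Ordinal.{u} := c δ '' Iio σ.ord

/-- The half-open interval `I(δ, ε, m) = (c_δ(ω·ε + m), c_δ(ω·ε + m + 1)]`. -/
def piece (c : Ordinal.{u} → Ordinal.{u} → Ordinal.{u}) (δ ε : Ordinal.{u}) (m : ℕ) :
    Set Ordinal.{u} := Ioc (c δ (ω * ε + m)) (c δ (ω * ε + m + 1))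

/-- `(c, C)` is an off-center club-guessing system along `S`. -/
structure IsGuessingSystem (μ σ : Cardinal.{u}) (S : Set Ordinal.{u}) (ν : ℕ → Cardinal.{u})
    (c : Ordinal.{u} → Ordinal.{u} → Ordinal.{u}) (C : Ordinal.{u} → Set Ordinal.{u}) :
    Prop where
  /-- `c δ` is an increasing enumeration, in order type `σ`, ... -/
  strictMonoOn : ∀ δ ∈ S, StrictMonoOn (c δ) (Iio σ.ord)
  /-- ... of a closed unbounded subset of `δ`. -/
  club_ran : ∀ δ ∈ S, IsClubIn δ (ran σ c δ)
  /-- The sets `ran (c δ)` guess clubs. -/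
  ran_guess : ∀ E, IsClubIn (lam μ) E → IsStationaryIn (lam μ) {δ ∈ S | ran σ c δ ⊆ E}
  club : ∀ δ ∈ S, IsClubIn δ (C δ)
  ran_subset : ∀ δ ∈ S, ran σ c δ ⊆ C δ
  card_le : ∀ δ ∈ S, ∀ ε < σ.ord, ∀ m : ℕ,
    #(C δ ∩ piece c δ ε m : Set Ordinal.{u}) ≤ Cardinal.lift.{u + 1} (Order.succ (ν m))
  lt_cof : ∀ δ ∈ S, ∀ ε < σ.ord, ∀ m : ℕ, ∀ α ∈ nacc (C δ) ∩ piece c δ ε m,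
    Order.succ (ν m) < α.cof
  /-- The sets `C δ` guess clubs, at non-accumulation points in every piece. -/
  guess : ∀ E, IsClubIn (lam μ) E → IsStationaryIn (lam μ)
    {δ ∈ S | ∀ ε < σ.ord, ∀ m : ℕ, (E ∩ nacc (C δ) ∩ piece c δ ε m).Nonempty}

/-- The generators of the ideal `I_δ` on `D = C_δ`. -/
def idealGen (D : Set Ordinal.{u}) (α β : Ordinal.{u}) :
    Set Ordinal.{u} :=
  {γ ∈ D | γ ∈ acc D ∨ γ.cof.ord < α ∨ γ < β}

/-- The ideal `I_δ` on `D = C_δ` generated by the sets `idealGen D α β` for `α < μ`, `β < δ`: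
the subsets of `D` covered by finitely many generators. -/
def localIdeal (μ : Cardinal.{u}) (δ : Ordinal.{u}) (D : Set Ordinal.{u}) :
    Set (Set Ordinal.{u}) :=
  {X | X ⊆ D ∧ ∃ F : Set (Set Ordinal.{u}), F.Finite ∧
    (∀ Y ∈ F, ∃ α < μ.ord, ∃ β < δ, Y = idealGen D α β) ∧ X ⊆ ⋃₀ F}

/-- The club-guessing ideal `id_p(C̄, Ī)` on `λ = μ⁺`. -/
def idp (μ : Cardinal.{u}) (S : Set Ordinal.{u}) (C : Ordinal.{u} → Set Ordinal.{u}) :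
    Set (Set Ordinal.{u}) :=
  {A | A ⊆ Iio (lam μ) ∧ ∃ E, IsClubIn (lam μ) E ∧
    ∀ δ ∈ S ∩ E, A ∩ E ∩ C δ ∈ localIdeal μ δ (C δ)}

/-- `φ β` holds for almost all `β < λ = μ⁺` with respect to a family `J` of null sets. -/
def AlmostAll (μ : Cardinal.{u}) (J : Set (Set Ordinal.{u})) (φ : Ordinal.{u} → Prop) : Prop :=
  {β | β < lam μ ∧ ¬ φ β} ∈ J

/-- The approximations `C_δ[m]`: the range of `c δ` together with the parts of `C_δ` lying in
the pieces `I(δ, ε, i)` with `i ≤ m`. -/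
def approx (σ : Cardinal.{u}) (c : Ordinal.{u} → Ordinal.{u} → Ordinal.{u})
    (C : Ordinal.{u} → Set Ordinal.{u}) (δ : Ordinal.{u}) (m : ℕ) : Set Ordinal.{u} :=
  ran σ c δ ∪ {γ ∈ C δ | ∃ ε < σ.ord, ∃ i ≤ m, γ ∈ piece c δ ε i}

/-- `e m α` (for `m < ω` and `α < λ`) is a generalized `C`-sequence on `λ`. -/
structure IsGeneralizedCSeq (l : Ordinal.{u}) (e : ℕ → Ordinal.{u} → Set Ordinal.{u}) :
    Prop where
  club : ∀ m, ∀ α < l, IsClubIn α (e m α)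
  subset_succ : ∀ m, ∀ α < l, e m α ⊆ e (m + 1) α

/-- A ladder-swallowing generalized `C`-sequence on `λ = μ⁺`. -/
structure IsSwallowing (μ σ : Cardinal.{u}) (S : Set Ordinal.{u}) (ν : ℕ → Cardinal.{u})
    (c : Ordinal.{u} → Ordinal.{u} → Ordinal.{u}) (C : Ordinal.{u} → Set Ordinal.{u})
    (e : ℕ → Ordinal.{u} → Set Ordinal.{u}) : Prop extends IsGeneralizedCSeq (lam μ) e where
  card_le : ∀ m, ∀ α < lam μ, #(e m α) ≤ Cardinal.lift.{u + 1} (α.cof + Order.succ (ν m))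
  swallow : ∀ m, ∀ α < lam μ, ∀ δ ∈ S ∩ e m α, approx σ c C δ m ⊆ e m α

open Classical in
/-- The `i`-th ordinal `β^m_i(α, β)` visited by the `m`-walk from `β` to `α`. -/
def walk (e : ℕ → Ordinal.{u} → Set Ordinal.{u}) (m : ℕ) (α β : Ordinal.{u}) : ℕ → Ordinal.{u}
  | 0 => β
  | i + 1 => if α < walk e m α β i then sInf (e m (walk e m α β i) \ Iio α) else α

/-- The length `ρ₂^m(α, β)` of the `m`-walk from `β` to `α`. -/
def rho2 (e : ℕ → Ordinal.{u} → Set Ordinal.{u}) (m : ℕ) (α β : Ordinal.{u}) : ℕ :=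
  sInf {i | walk e m α β i = α}

/-- The `m`-walk from `β` to `α`, that is `⟨β^m_i(α, β) : i < ρ₂^m(α, β)⟩`, is defined (`α < β`)
and passes through `γ`. -/
def PassesThrough (e : ℕ → Ordinal.{u} → Set Ordinal.{u}) (m : ℕ) (β α γ : Ordinal.{u}) : Prop :=
  α < β ∧ ∃ i < rho2 e m α β, walk e m α β i = γ

end OffCenter

end

open OffCenter

namespace OffCenter

/-! ### Cofinality -/

/-! For each `γ` pick `a γ` with `t (a γ)` above `γ`, and let `E` be a club of closure points
bounding these sets. If the bad points in `E ∩ C δ` were `I_δ`-positive for some `δ ∈ S`, look at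
the walks from the finitely many `ξ ∈ t (a δ)` towards `δ`. They stabilise for large `m` and are
unaffected when the target drops from `δ` to an ordinal close enough below it
(`IsSwallowing.exists_walk_eq`). Positivity yields a bad `b ∈ nacc (C δ) ∩ E` near `δ` of large
cofinality, and `exists_mem_approx` gives a large `m` with `b ∈ C_δ[m]` and `cf b > μ_m⁺`. A ladder
that contains `δ` then swallows `b` but is bounded below `b`, so every walk to a target just below
`b` stops at `b`. Since `b ∈ E`, some `t (a η')` consists of such targets, so `b` was not bad. -/

theorem exists_lt_forall_lt_of_mk_lt {o : Ordinal.{u}} {D : Set Ordinal.{u}}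
    (hD : #D < Cardinal.lift.{u + 1} o.cof) : ∃ η < o, ∀ x ∈ D, x < o → x < η := by
  by_contra! h
  have hcof : IsCofinal (Subtype.val ⁻¹' D : Set (Iio o)) := fun a ↦ by
    obtain ⟨x, hx, hxo, hax⟩ := h a a.2
    exact ⟨⟨x, hxo⟩, hx, hax⟩
  have h1 := Order.cof_le hcof
  rw [cof_Iio, ← lift_cof] at h1
  exact (h1.trans (mk_preimage_of_injective _ _ Subtype.val_injective)).not_gt hD

theorem IsClubIn.exists_lt_forall_lt {ξ δ : Ordinal.{u}} {D : Set Ordinal.{u}}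
    (hD : IsClubIn ξ D) (hδ : δ ≠ 0) (hδξ : δ < ξ) (hδD : δ ∉ D) :
    ∃ γ < δ, ∀ x ∈ D, x < δ → x ≤ γ := by
  by_contra! h
  refine hδD (hD.2.isLUB_mem (t := {x | x.1 ∈ D ∧ x.1 < δ}) (x := ⟨δ, hδξ⟩)
    (fun x hx ↦ hx.1) ?_ ⟨fun x hx ↦ hx.2.le, fun y hy ↦ ?_⟩)
  · obtain ⟨x, hx, hxδ, -⟩ := h 0 (pos_iff_ne_zero.2 hδ)
    exact ⟨⟨x, hxδ.trans hδξ⟩, hx, hxδ⟩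
  · by_contra! hlt
    obtain ⟨x, hx, hxδ, hyx⟩ := h y.1 hlt
    exact hyx.not_ge (hy (a := ⟨x, hxδ.trans hδξ⟩) ⟨hx, hxδ⟩)

theorem cof_lt_of_isSingular {μ : Cardinal.{u}} (hμ : μ.IsSingular) {ξ : Ordinal.{u}}
    (hξ : ξ < lam μ) : ξ.cof < μ := by
  refine lt_of_le_of_ne ((cof_le_card ξ).trans (Order.lt_succ_iff.1 (lt_ord.1 hξ))) fun h ↦ ?_
  have := cof_ord_cof ξ
  rw [h] at this
  exact hμ.cof_ord_ne this

/-! ### Walks -/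

section walk

variable {l : Ordinal.{u}} {e : ℕ → Ordinal.{u} → Set Ordinal.{u}} {m : ℕ} {α β γ : Ordinal.{u}}

theorem walk_succ (hαβ : α < β) (i : ℕ) :
    walk e m α β (i + 1) = walk e m α (sInf (e m β \ Iio α)) i := by
  induction i with
  | zero => simp [walk, hαβ]
  | succ i ih => rw [walk, ih]; rfl

theorem IsGeneralizedCSeq.nonempty (he : IsGeneralizedCSeq l e) (hαβ : α < β) (hβ : β < l) :
    (e m β \ Iio α).Nonempty := by
  obtain ⟨x, hx, hαx⟩ := (he.club m β hβ).2.isCofinal ⟨α, hαβ⟩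
  exact ⟨x, hx, not_lt.2 hαx⟩

theorem IsGeneralizedCSeq.sInf_mem (he : IsGeneralizedCSeq l e) (hαβ : α < β) (hβ : β < l) :
    sInf (e m β \ Iio α) ∈ e m β ∧ α ≤ sInf (e m β \ Iio α) ∧ sInf (e m β \ Iio α) < β := by
  have h := csInf_mem (he.nonempty (m := m) hαβ hβ)
  exact ⟨h.1, not_lt.1 h.2, (he.club m β hβ).1 h.1⟩

theorem IsGeneralizedCSeq.exists_walk_eq (he : IsGeneralizedCSeq l e) (hαβ : α ≤ β) (hβ : β < l) :
    ∃ i, walk e m α β i = α := by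
  induction β using WellFoundedLT.induction with
  | ind β ih =>
  obtain rfl | h := hαβ.eq_or_lt
  · exact ⟨0, rfl⟩
  · have := he.sInf_mem (m := m) h hβ
    obtain ⟨i, hi⟩ := ih _ this.2.2 this.2.1 (this.2.2.trans hβ)
    exact ⟨i + 1, by rw [walk_succ h, hi]⟩

theorem walk_eq_of_le {i j : ℕ} (hij : i ≤ j) (hi : walk e m α β i = α) :
    walk e m α β j = α := by
  induction j, hij using Nat.le_induction with
  | base => exact hi
  | succ j _ ih => simp [walk, ih]

theorem IsGeneralizedCSeq.passesThrough (he : IsGeneralizedCSeq l e) (hαβ : α < β) (hβ : β < l)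
    (hαγ : α < γ) {i : ℕ} (hi : walk e m α β i = γ) : PassesThrough e m β α γ := by
  refine ⟨hαβ, i, ?_, hi⟩
  by_contra! h
  have h1 := csInf_mem (he.exists_walk_eq (m := m) hαβ.le hβ)
  -- Once at its target the walk stays there, so a visit to `γ ≠ α` precedes step `ρ₂`.
  exact hαγ.ne' (hi ▸ walk_eq_of_le h h1)

theorem exists_forall_ge_eq_of_antitone (f : ℕ → Ordinal.{u}) (hf : Antitone f) :
    ∃ n, ∀ m ≥ n, f m = f n := by
  obtain ⟨n, hn⟩ := exists_minimalFor_of_wellFoundedLT (fun _ : ℕ ↦ True) f ⟨0, trivial⟩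
  exact ⟨n, fun m hm ↦ (hf hm).antisymm (hn.2 trivial (hf hm))⟩

/-- The ladders grow with `m`, so their minima above `α` descend, and descending sequences of
ordinals are eventually constant. -/
theorem IsGeneralizedCSeq.exists_forall_ge_sInf_eq (he : IsGeneralizedCSeq l e) (hαβ : α < β)
    (hβ : β < l) : ∃ n, ∀ m ≥ n, sInf (e m β \ Iio α) = sInf (e n β \ Iio α) := by
  refine exists_forall_ge_eq_of_antitone (fun m ↦ sInf (e m β \ Iio α))
    (antitone_nat_of_succ_le fun m ↦ ?_)
  exact csInf_le_csInf (OrderBot.bddBelow _) (he.nonempty hαβ hβ)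
    (sdiff_subset_sdiff_left (he.subset_succ m β hβ))

end walk

/-- Walks to `δ` stabilise as `m` grows, so an ordinal `b < δ` of large cofinality that lies in
`approx σ c C δ m` is visited by the `m`-walks from `ξ` to all `ζ` in a final segment of `b`. -/
theorem IsSwallowing.exists_walk_eq {μ σ : Cardinal.{u}} {S : Set Ordinal.{u}}
    {ν : ℕ → Cardinal.{u}} {c : Ordinal.{u} → Ordinal.{u} → Ordinal.{u}}
    {C : Ordinal.{u} → Set Ordinal.{u}} {e : ℕ → Ordinal.{u} → Set Ordinal.{u}}
    (hμ : IsCardinalSetup μ σ S ν) (he : IsSwallowing μ σ S ν c C e) {δ : Ordinal.{u}}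
    (hδ : δ ∈ S) (ξ : Ordinal.{u}) (hδξ : δ < ξ) (hξ : ξ < lam μ) :
    ∃ n : ℕ, ∃ κ < μ, ∃ γ < δ, ∀ m ≥ n, ∀ b ∈ approx σ c C δ m, γ < b → b < δ →
      κ < b.cof → Order.succ (ν m) < b.cof →
      ∃ η < b, ∀ ζ, η ≤ ζ → ζ < b → ∃ i, walk e m ζ ξ i = b := by
  have hcof : ℵ₀ < δ.cof := hμ.cof_of_mem δ hδ ▸ hμ.aleph0_lt
  have hδ0 : δ ≠ 0 := by rintro rfl; simp at hcof
  induction ξ using WellFoundedLT.induction with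
  | ind ξ ih =>
  obtain ⟨n₀, hn₀⟩ := he.exists_forall_ge_sInf_eq hδξ hξ
  set w := sInf (e n₀ ξ \ Iio δ) with hw
  have hwm (m : ℕ) (hm : n₀ ≤ m) : w ∈ e m ξ ∧ δ ≤ w ∧ w < ξ :=
    hn₀ m hm ▸ he.sInf_mem hδξ hξ
  obtain ⟨-, hδw, hwξ⟩ := hwm n₀ le_rfl
  obtain hδw | hδw := hδw.eq_or_lt
  -- Here `δ ∈ e m ξ`. With `κ = cf ξ`, the ladder has size below `cf b`, so it is bounded below
  -- `b`, and the first step goes straight to `b`.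
  · refine ⟨n₀, ξ.cof, cof_lt_of_isSingular hμ.singular hξ, 0, pos_iff_ne_zero.2 hδ0,
      fun m hm b hb _ hbδ hκ hν ↦ ?_⟩
    have hbe : b ∈ e m ξ := he.swallow m ξ hξ δ ⟨hδ, hδw ▸ (hwm m hm).1⟩ hb
    have hlt : ξ.cof + Order.succ (ν m) < b.cof :=
      add_lt_of_lt (((hμ.nu_regular m).aleph0_le.trans (Order.le_succ _)).trans hν.le) hκ hν
    obtain ⟨η, hη, hηe⟩ := exists_lt_forall_lt_of_mk_lt
      ((he.card_le m ξ hξ).trans_lt (Cardinal.lift_lt.2 hlt))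
    refine ⟨η, hη, fun ζ hηζ hζb ↦ ⟨1, ?_⟩⟩
    have hζξ := hζb.trans (hbδ.trans hδξ)
    rw [walk_succ hζξ, walk]
    refine le_antisymm (csInf_le (OrderBot.bddBelow _) ⟨hbe, not_lt.2 hζb.le⟩) ?_
    have := he.sInf_mem (m := m) hζξ hξ
    by_contra! hlt'
    exact ((hηe _ this.1 hlt').trans_le hηζ).not_ge this.2.1
  · obtain ⟨n₁, κ, hκ, γ, hγ, H⟩ := ih w hwξ hδw (hwξ.trans hξ)
    have hgap (m : ℕ) (hm : n₀ ≤ m) (x) (hx : x ∈ e m ξ) (hδx : δ ≤ x) : w ≤ x :=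
      hn₀ m hm ▸ csInf_le (OrderBot.bddBelow _) ⟨hx, not_lt.2 hδx⟩
    -- Now `δ ∉ e m ξ`, so the ladder is bounded below `δ`. As `cf δ` is uncountable, one `γ' < δ`
    -- serves all `m`; above it the first step is `w`, as in the walk to `δ`.
    have hδe (m : ℕ) : ∃ γ < δ, n₀ ≤ m → ∀ x ∈ e m ξ, x < δ → x ≤ γ := by
      by_cases hm : n₀ ≤ m
      · obtain ⟨g, hg, h⟩ := (he.club m ξ hξ).exists_lt_forall_lt hδ0 hδξ
          fun h ↦ (hgap m hm δ h le_rfl).not_gt hδw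
        exact ⟨g, hg, fun _ ↦ h⟩
      · exact ⟨0, pos_iff_ne_zero.2 hδ0, fun h ↦ (hm h).elim⟩
    choose g hg hge using hδe
    obtain ⟨γ', hγ', hgγ⟩ := exists_lt_forall_lt_of_mk_lt (o := δ) (D := range g)
      (by
        exact (le_aleph0_iff_set_countable.2 (countable_range g)).trans_lt (by
        rw [aleph0_lt_lift]; exact hcof))
    refine ⟨max n₀ n₁, κ, hκ, max γ γ', max_lt hγ hγ', fun m hm b hb hγb hbδ hκb hνb ↦ ?_⟩
    have hγb' := max_lt_iff.1 hγb
    obtain ⟨η, hη, hηw⟩ := H m (le_of_max_le_right hm) b hb hγb'.1 hbδ hκb hνb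
    refine ⟨max η γ', max_lt hη hγb'.2, fun ζ hζ hζb ↦ ?_⟩
    obtain ⟨i, hi⟩ := hηw ζ (le_of_max_le_left hζ) hζb
    have hζξ := hζb.trans (hbδ.trans hδξ)
    refine ⟨i + 1, ?_⟩
    have hm0 := le_of_max_le_left hm
    have : sInf (e m ξ \ Iio ζ) = w := by
      have h := he.sInf_mem (m := m) hζξ hξ
      refine le_antisymm (csInf_le (OrderBot.bddBelow _)
        ⟨(hwm m hm0).1, not_lt.2 ((hζb.trans hbδ).trans hδw).le⟩) (hgap m hm0 _ h.1 ?_)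
      by_contra! hlt
      exact (((hge m hm0 _ h.1 hlt).trans_lt (hgγ _ ⟨m, rfl⟩ (hg m))).trans_le
        (le_of_max_le_right hζ)).not_ge h.2.1
    rw [walk_succ hζξ, this, hi]

/-! ### Ladders -/

/-- Points of `ran σ c δ` lie in every approximation. Any other `b` lies in a piece of some index
`k`, where `cf b > μ_k⁺`, and `m = max n k` works. -/
theorem exists_mem_approx {μ σ : Cardinal.{u}} {S : Set Ordinal.{u}}
    {ν : ℕ → Cardinal.{u}} {c : Ordinal.{u} → Ordinal.{u} → Ordinal.{u}}
    {C : Ordinal.{u} → Set Ordinal.{u}}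
    (hC : IsGuessingSystem μ σ S ν c C) {δ b : Ordinal.{u}} (hδ : δ ∈ S) (hb : b ∈ nacc (C δ))
    (h0 : c δ 0 < b) {n : ℕ} (hn : Order.succ (ν n) < b.cof) :
    ∃ m ≥ n, b ∈ approx σ c C δ m ∧ Order.succ (ν m) < b.cof := by
  by_cases hran : b ∈ ran σ c δ
  · exact ⟨n, le_rfl, .inl hran, hn⟩
  have hbδ : b < δ := (hC.club δ hδ).1 hb.1
  have hbound : ∃ j < σ.ord, b < c δ j := by
    obtain ⟨⟨_, _⟩, ⟨j, hj, rfl⟩, hle⟩ := (hC.club_ran δ hδ).2.isCofinal ⟨b, hbδ⟩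
    exact ⟨j, hj, lt_of_le_of_ne hle fun h ↦ hran ⟨j, hj, h.symm⟩⟩
  obtain ⟨j, ⟨hj, hbj⟩, hmin⟩ := exists_minimal_of_wellFoundedLT
    (fun j ↦ j < σ.ord ∧ b < c δ j) hbound
  have hlt : ∀ i < j, c δ i < b := fun i hi ↦ by
    by_contra! hle
    refine (hmin ⟨hi.trans hj, lt_of_le_of_ne hle fun h ↦ hran ⟨i, hi.trans hj, h.symm⟩⟩
      hi.le).not_gt hi
  obtain rfl | ⟨i, rfl⟩ | hlim := zero_or_succ_or_isSuccLimit j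
  · exact (h0.not_gt hbj).elim
  · rw [Order.succ_eq_add_one] at *
    obtain ⟨k, hk⟩ := lt_omega0.1 (mod_lt i omega0_ne_zero)
    have hi : ω * (i / ω) + k = i := by rw [← hk, div_add_mod]
    have hiσ : i < σ.ord := (Order.lt_succ i).trans hj
    have hε : i / ω < σ.ord := (le_mul_right _ omega0_pos).trans_lt
      ((le_self_add.trans hi.le).trans_lt hiσ)
    have hp : b ∈ piece c δ (i / ω) k := by
      rw [piece, hi]
      exact ⟨hlt i (Order.lt_succ i), hbj.le⟩
    have hbk := hC.lt_cof δ hδ _ hε k b ⟨hb, hp⟩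
    refine ⟨max n k, le_max_left _ _, .inr ⟨hb.1, _, hε, k, le_max_right _ _, hp⟩, ?_⟩
    obtain h | h := max_choice n k <;> rw [h] <;> assumption
  -- A limit `j` is impossible: the supremum `s ≤ b` of the earlier values would belong to the
  -- closed set `ran σ c δ`, hence equal an earlier value.
  · obtain ⟨s, hs, hsmin⟩ := exists_minimal_of_wellFoundedLT (fun s ↦ ∀ i < j, c δ i ≤ s)
      ⟨b, fun i hi ↦ (hlt i hi).le⟩
    have hsb : s ≤ b := by
      by_contra! h
      exact (hsmin (fun i hi ↦ (hlt i hi).le) h.le).not_gt h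
    have hlt_s : ∀ i < j, c δ i < s := fun i hi ↦
      (hC.strictMonoOn δ hδ (hi.trans hj) ((hlim.succ_lt hi).trans hj)
        (Order.lt_succ i)).trans_le (hs _ (hlim.succ_lt hi))
    by_cases hsr : s ∈ ran σ c δ
    · obtain ⟨k, hk, rfl⟩ := hsr
      have hkj : k < j := by
        by_contra! h
        exact (hsb.trans_lt hbj).not_ge ((hC.strictMonoOn δ hδ).monotoneOn hj hk h)
      exact ((hlt_s k hkj).false).elim
    · obtain ⟨γ, hγ, H⟩ := (hC.club_ran δ hδ).exists_lt_forall_lt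
        (hlt_s 0 hlim.pos).ne_bot (hsb.trans_lt hbδ) hsr
      exact (hγ.not_ge (hsmin (fun i hi ↦ H _ ⟨i, hi.trans hj, rfl⟩ (hlt_s i hi)) hγ.le)).elim

/-! ### Disjoint families -/

section family

variable {μ : Cardinal.{u}} {t : Ordinal.{u} → Finset Ordinal.{u}}

/-- Otherwise choosing an element `≤ γ` from each set with index past `γ` would inject `μ⁺` into `γ
+ 1`, by disjointness. -/
theorem exists_forall_lt_of_pairwiseDisjoint (hμ : ℵ₀ ≤ μ)
    (htd : (Iio (lam μ)).PairwiseDisjoint t) {γ : Ordinal.{u}} (hγ : γ < lam μ) :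
    ∃ a < lam μ, γ < a ∧ ∀ x ∈ t a, γ < x := by
  have hlim : Order.IsSuccLimit (lam μ) := isSuccLimit_ord (hμ.trans (Order.le_succ _))
  by_contra! h
  have hlt (a : Iio (lam μ)) : Order.succ γ + a.1 < lam μ :=
    isPrincipal_add_ord (hμ.trans (Order.le_succ _)) (hlim.succ_lt hγ) a.2
  choose f hf hfγ using fun a : Iio (lam μ) ↦ h _ (hlt a)
    ((Order.lt_succ γ).trans_le le_self_add)
  have hinj : Function.Injective
      (fun a ↦ (⟨f a, Order.lt_succ_iff.2 (hfγ a)⟩ : Iio (Order.succ γ))) :=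
    fun a b hab ↦ by
      by_contra hne
      have hne' : Order.succ γ + a.1 ≠ Order.succ γ + b.1 := fun h ↦
        hne (Subtype.ext (by simpa using h))
      refine Finset.disjoint_left.1 (htd (hlt a) (hlt b) hne') (hf a) ?_
      rw [show f a = f b from congrArg Subtype.val hab]
      exact hf b
  have hcard : #(Iio (lam μ)) ≤ #(Iio (Order.succ γ)) := mk_le_of_injective hinj
  rw [Cardinal.mk_Iio_ordinal, Cardinal.mk_Iio_ordinal, Cardinal.lift_le, lam, card_ord] at hcard
  exact hcard.not_gt (lt_ord.1 (hlim.succ_lt hγ))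

/-- Unboundedness: by regularity of `μ⁺`, `h` is bounded on each initial segment; iterate such
bounds `ω` times and take the supremum. -/
theorem isClubIn_closurePoints (hμ : ℵ₀ ≤ μ) (h : Ordinal.{u} → Ordinal.{u})
    (hh : ∀ γ < lam μ, h γ < lam μ) :
    IsClubIn (lam μ) {y | y < lam μ ∧ ∀ γ < y, h γ ≤ y} := by
  have hreg : Cardinal.IsRegular (Order.succ μ) := isRegular_succ hμ
  have hcof : (lam μ).cof = Order.succ μ := hreg.cof_ord
  refine ⟨fun y hy ↦ hy.1, fun s hs _ _ a ha ↦ ⟨a.2, fun γ hγ ↦ ?_⟩, fun x ↦ ?_⟩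
  · obtain ⟨y, hy, hγy⟩ := (lt_isLUB_iff ha (b := ⟨γ, hγ.trans a.2⟩)).1 hγ
    exact ((hs hy).2 γ hγy).trans (ha.1 hy)
  · have hg : ∀ x < lam μ, ∃ y < lam μ, x ≤ y ∧ ∀ γ < x, h γ ≤ y := fun x hx ↦ by
      obtain ⟨y, hy, H⟩ := exists_lt_forall_lt_of_mk_lt (o := lam μ) (D := h '' Iio x)
        (mk_image_le.trans_lt (by
          rw [Cardinal.mk_Iio_ordinal, hcof, Cardinal.lift_lt]
          exact lt_ord.1 hx))
      exact ⟨max x y, max_lt hx hy, le_max_left _ _, fun γ hγ ↦ le_max_of_le_right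
        (H _ ⟨γ, hγ, rfl⟩ (hh γ (hγ.trans hx))).le⟩
    choose! g hg hgx hgh using hg
    have hit (n : ℕ) : g^[n] x < lam μ := by
      induction n with
      | zero => exact x.2
      | succ n ih => rw [Function.iterate_succ_apply']; exact hg _ ih
    obtain ⟨y, hy, H⟩ := exists_lt_forall_lt_of_mk_lt (o := lam μ) (D := range fun n ↦ g^[n] x)
      ((le_aleph0_iff_set_countable.2 (countable_range _)).trans_lt (by
        rw [hcof, aleph0_lt_lift]
        exact hμ.trans_lt (Order.lt_succ μ)))
    have hub : BddAbove (range fun n ↦ g^[n] x) :=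
      ⟨y, by rintro _ ⟨n, rfl⟩; exact (H _ ⟨n, rfl⟩ (hit n)).le⟩
    refine ⟨⟨⨆ n, g^[n] x, (ciSup_le fun n ↦ (H _ ⟨n, rfl⟩ (hit n)).le).trans_lt hy⟩,
      ⟨(ciSup_le fun n ↦ (H _ ⟨n, rfl⟩ (hit n)).le).trans_lt hy, fun γ hγ ↦ ?_⟩, le_ciSup hub 0⟩
    obtain ⟨n, hn⟩ := exists_lt_of_lt_ciSup hγ
    refine (hgh _ (hit n) γ hn).trans ?_
    exact (Function.iterate_succ_apply' g n x.1).symm.le.trans (le_ciSup hub (n + 1))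

end family

/-- A single generator does not cover `X`, and a point outside it meets all three demands at once.
-/
theorem exists_lt_forall_idealGen_of_notMem {μ : Cardinal.{u}} {δ : Ordinal.{u}}
    {D X : Set Ordinal.{u}} (hX : X ⊆ D) (h : X ∉ localIdeal μ δ D) {κ : Cardinal.{u}}
    (hκ : κ < μ) {β : Ordinal.{u}} (hβ : β < δ) :
    ∃ b ∈ X, b ∈ nacc D ∧ κ ≤ b.cof ∧ β ≤ b := by
  by_contra! H
  refine h ⟨hX, {idealGen D κ.ord β}, finite_singleton _, ?_, ?_⟩
  · rintro _ rfl
    exact ⟨κ.ord, ord_lt_ord.2 hκ, β, hβ, rfl⟩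
  · rw [sUnion_singleton]
    refine fun b hb ↦ ⟨hX hb, ?_⟩
    by_contra! hb'
    exact (H b hb ⟨hX hb, hb'.1⟩ (ord_le_ord.1 hb'.2.1)).not_ge hb'.2.2

theorem exists_lt_forall_le {ι α : Type*} [LinearOrder α] (s : Finset ι) (f : ι → α) {a b : α}
    (hab : a < b) (hf : ∀ i ∈ s, f i < b) : ∃ c, a ≤ c ∧ c < b ∧ ∀ i ∈ s, f i ≤ c := by
  classical
  induction s using Finset.induction_on with
  | empty => exact ⟨a, le_rfl, hab, by simp⟩
  | insert i s _ ih =>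
    obtain ⟨c, hac, hcb, hc⟩ := ih fun j hj ↦ hf j (Finset.mem_insert_of_mem hj)
    refine ⟨max c (f i), le_max_of_le_left hac,
      max_lt hcb (hf i (Finset.mem_insert_self i s)), fun j hj ↦ ?_⟩
    obtain rfl | hj := Finset.mem_insert.1 hj
    · exact le_max_right _ _
    · exact le_max_of_le_left (hc j hj)

end OffCenter

/-! ### The main argument -/

theorem theorem6p1 {μ σ : Cardinal.{u}} {S : Set Ordinal.{u}} {ν : ℕ → Cardinal.{u}}
    {c : Ordinal.{u} → Ordinal.{u} → Ordinal.{u}} {C : Ordinal.{u} → Set Ordinal.{u}}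
    {e : ℕ → Ordinal.{u} → Set Ordinal.{u}}
    (hμ : IsCardinalSetup μ σ S ν) (hC : IsGuessingSystem μ σ S ν c C)
    (he : IsSwallowing μ σ S ν c C e)
    (t : Ordinal.{u} → Finset Ordinal.{u})
    (ht : ∀ α < lam μ, ∀ ζ ∈ t α, ζ < lam μ)
    (htd : (Set.Iio (lam μ)).PairwiseDisjoint t) :
    AlmostAll μ (idp μ S C) (fun βs => ∃ α β : Ordinal.{u}, α < β ∧ β < lam μ ∧ ∃ m : ℕ,
      ∀ ζ ∈ t α, ∀ ξ ∈ t β, PassesThrough e m ξ ζ βs) := by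
  have hμ0 : ℵ₀ ≤ μ := hμ.singular.aleph0_le
  choose! a haL hγa hat using
    fun γ (hγ : γ < lam μ) ↦ exists_forall_lt_of_pairwiseDisjoint hμ0 htd hγ
  have hbound : ∀ γ < lam μ, ∃ y < lam μ, a γ < y ∧ ∀ x ∈ t (a γ), x < y := fun γ hγ ↦ by
    obtain ⟨y, hay, hy, H⟩ := exists_lt_forall_le (t (a γ)) id (haL γ hγ) (ht _ (haL γ hγ))
    exact ⟨Order.succ y, (isSuccLimit_ord (hμ0.trans (Order.le_succ _))).succ_lt hy,
      Order.lt_succ_iff.2 hay, fun x hx ↦ Order.lt_succ_iff.2 (H x hx)⟩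
  choose! h hhL hah hth using hbound
  unfold AlmostAll
  refine ⟨fun b hb ↦ hb.1, _, isClubIn_closurePoints hμ0 h hhL, fun δ hδ ↦ ?_⟩
  by_contra hnot
  obtain ⟨hδ, -⟩ := hδ
  have hδL : δ < lam μ := hμ.stationary.1 hδ
  have hδa := hγa δ hδL
  have key : ∀ ξ ∈ t (a δ), _ := fun ξ hξ ↦
    IsSwallowing.exists_walk_eq hμ he hδ ξ (hat δ hδL ξ hξ) (ht _ (haL δ hδL) ξ hξ)
  choose! n κ hκ γ hγ key using key
  have hc0 : c δ 0 < δ := (hC.club_ran δ hδ).1 ⟨0, hμ.regular.ord_pos, rfl⟩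
  obtain ⟨γ', hγ0, hγδ, hγγ⟩ := exists_lt_forall_le _ γ hc0 hγ
  set N := (t (a δ)).sup n
  have hsucc : ∀ κ < μ, Order.succ κ < μ := fun κ hκ ↦ hμ.singular.isSuccLimit.succ_lt hκ
  obtain ⟨κ', hνκ, hκμ, hκκ⟩ := exists_lt_forall_le _ κ (hsucc _ (hμ.nu_lt N)) hκ
  have hδlim : Order.IsSuccLimit δ := one_lt_cof_iff.1
    (hμ.cof_of_mem δ hδ ▸ one_lt_aleph0.trans hμ.aleph0_lt)
  -- Successors of the thresholds are used so that the weak bounds become strict.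
  obtain ⟨b, ⟨⟨hbA, hbE⟩, -⟩, hbn, hbκ, hbγ⟩ := exists_lt_forall_idealGen_of_notMem
    inter_subset_right hnot (hsucc _ hκμ) (hδlim.succ_lt hγδ)
  replace hbκ := Order.succ_le_iff.1 hbκ
  replace hbγ := Order.succ_le_iff.1 hbγ
  have hbδ : b < δ := (hC.club δ hδ).1 hbn.1
  obtain ⟨m, hm, hbm, hνm⟩ := exists_mem_approx hC hδ hbn (hγ0.trans_lt hbγ)
    (hνκ.trans_lt hbκ)
  have hη : ∀ ξ ∈ t (a δ), ∃ η < b, ∀ ζ, η ≤ ζ → ζ < b → ∃ i, walk e m ζ ξ i = b := fun ξ hξ ↦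
    key ξ hξ m ((Finset.le_sup hξ).trans hm) b hbm ((hγγ ξ hξ).trans_lt hbγ) hbδ
      ((hκκ ξ hξ).trans_lt hbκ) hνm
  choose! η hηb hη using hη
  obtain ⟨η', -, hηb', hηη⟩ := exists_lt_forall_le _ η ((zero_le).trans_lt hbγ) hηb
  have hηL := hηb'.trans hbE.1
  -- As `η' < b` and `b` is a closure point of `h`, all of `t (a η')` lies strictly between `η'` and
  -- `b`.
  refine hbA.2 ⟨a η', a δ, ?_, haL δ hδL, m, fun ζ hζ ξ hξ ↦ ?_⟩
  · exact (hah η' hηL).trans_le ((hbE.2 η' hηb').trans (hbδ.trans hδa).le)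
  · have hζb : ζ < b := (hth η' hηL ζ hζ).trans_le (hbE.2 η' hηb')
    obtain ⟨i, hi⟩ := hη ξ hξ ζ ((hηη ξ hξ).trans (hat η' hηL ζ hζ).le) hζb
    exact he.passesThrough (hζb.trans (hbδ.trans (hat δ hδL ξ hξ))) (ht _ (haL δ hδL) ξ hξ) hζb hi
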